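/- **Setting.** Fix $l^*\ge 0$ and locations $0<t_1^*<\cdots<t_{l^*}^*<1$. For each $n$ let $x_{n,i}\in\mathbb R^{p_n}$ ($1\le i\le n$) be deterministic covariate vectors. For $t=(t_1<\dots<t_{l^*})\subset(0,1)$ let the segments be $P_j=\{i: nt_{j-1}<i\le nt_j\}$, $j=1,\dots,l^*+1$ (with $t_0=0$, $t_{l^*+1}=1$); $P_j^*$ are the segments of $t^*$. The responses $Y_1,\dots,Y_n$ are independent, $Y_i\sim N(x_{n,i}'\beta_n^{*j},\sigma^2)$ for $i\in P_j^*$, with $\sigma^2>0$ known and fixed. Let $m^*_n$ be the set of covariates $c$ with $\beta^{*j}_{n,c}\ne0$ for some $j$. For a model $M=(t,m)$, with locations $t$ and covariate set $m$, let $L(Y\mid M)=\int\prod_j\prod_{i\in P_j}\varphi_{\sigma^2}(Y_i-x_{n,i}'\beta^j)\,d\pi(\beta)$, where $\varphi_{\sigma^2}$ is the $N(0,\sigma^2)$ density and under $\pi$ the coefficients $\beta^j_c$ are independent, $N(0,V_n)$ for $c\in m$ and equal to $0$ for $c\notin m$. Put $M^*=(t^*,m_n^*)$ and $BF(M,M^*)=L(Y\mid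 M)/L(Y\mid M^*)$. Let $q_n$ be nonnegative integers with $|m_n^*|\le q_n$ for large $n$. **Assumptions.** - (A1) $\sup_{n,i,c}|x_{n,i,c}|<\infty$. - (A2) $\sup_{n,j,c}|\beta^{*j}_{n,c}|<\infty$, and there is $\delta>0$ such that $\|\beta_n^{*(j+1)}-\beta_n^{*j}\|_2^2\ge\delta$ for $1\le j\le l^*$ and all large $n$ (for coefficients not depending on $n$ this is $\beta^{*(j+1)}\neq\beta^{*j}$). - (A3) $\varepsilon_n\to0$, $n\varepsilon_n\to\infty$, $(q_n\log n)^2/(n\varepsilon_n)\to0$, and $q_n^2\le Kn^c$ for large $n$, for some constants $K$ and $c<1/2$. - (A4) $V_n$ is bounded above and bounded away from $0$. - (A5) $0<t_1^*<\cdots<t_{l^*}^*<1$, as above. - (A6) for covariate sets $S_n$: there are $a,b>0$ such that, for every $k$ and all disjoint blocks $\tilde P_{n,1},\dots,\tilde P_{n,k}$ of consecutive indices in $\{1,\dots,n\}$ whose sizes $n_i$ satisfy $n_i\to\infty$ and $q_n/n_i\to0$, for all large $n$ and all $i$ the singular values of $X_i'X_i$ lie in $(an_i,bn_i)$ and those of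 $(\sum_jX_j'X_j)^{-1}X_i'X_i$ lie in $\big(a\frac{n_i}{\sum_jn_j},b\frac{n_i}{\sum_jn_j}\big)$, where $X_i$ is the design matrix with rows $\tilde P_{n,i}$ and columns $S_n$. **Theorem.** Let $m_n$ be any covariate sets with $|m_n|\le q_n$ for large $n$. Assume (A1), (A2), (A4), (A5), and (A6) for $S_n=m_n\cup m_n^*$. 1. If $\varepsilon_n$ satisfies (A3) and $t^{(n)}=(t^{(n)}_1<\dots<t^{(n)}_{l^*})\subset(0,1)$ are any locations with $\max_i|t^{(n)}_i-t^*_i|>\varepsilon_n$ for all large $n$, then $BF\big((t^{(n)},m_n),M^*\big)\to0$ in probability as $n\to\infty$. 2. In particular, if $q_n=O(\log n)$, then for every $r>4$ the same conclusion holds for any locations $t^{(n)}$ (ordered, in $(0,1)$) with $\max_i|t^{(n)}_i-t_i^*|>(\log n)^r/n$ for all large $n$; that is, the localization rate is $n^{-1}$ up to logarithmic factors. -/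

import Mathlib

open MeasureTheory ProbabilityTheory Filter Topology
open scoped NNReal

noncomputable section

namespace ChangePoint

/-- With change-point locations `t 0 < ⋯ < t (l-1)` in `(0,1)`, the observation with (1-based)
time index `i + 1` lies in the segment number `#{k : n * t k < i + 1}`; that is, segment `k`
consists of the times `s` with `n * t (k-1) < s ≤ n * t k` (with `0` and `1` as outer locations). -/
def segmentIndex {l : ℕ} (t : Fin l → ℝ) (n : ℕ) (i : Fin n) : Fin (l + 1) :=
  ⟨(Finset.univ.filter fun k : Fin l => (n : ℝ) * t k < (i : ℝ) + 1).card,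
    Nat.lt_succ_of_le ((Finset.card_le_univ _).trans (Fintype.card_fin l).le)⟩

/-- The regression function: the mean of the `i`-th response if the coefficient vector in
segment `j` is `β j`. -/
def regMean {l n p : ℕ} (x : Fin n → Fin p → ℝ) (t : Fin l → ℝ) (β : Fin (l + 1) → Fin p → ℝ)
    (i : Fin n) : ℝ :=
  ∑ c, x i c * β (segmentIndex t n i) c

/-- The law of the response vector: independent normal entries with variance `σ2`. -/
def dataLaw {l n p : ℕ} (x : Fin n → Fin p → ℝ) (t : Fin l → ℝ) (β : Fin (l + 1) → Fin p → ℝ)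
    (σ2 : ℝ≥0) : Measure (Fin n → ℝ) :=
  Measure.pi fun i => gaussianReal (regMean x t β i) σ2

/-- The Gaussian likelihood of the response vector `y`, for known error variance `σ2`. -/
def likelihood {l n p : ℕ} (x : Fin n → Fin p → ℝ) (t : Fin l → ℝ) (σ2 : ℝ≥0)
    (y : Fin n → ℝ) (β : Fin (l + 1) → Fin p → ℝ) : ℝ :=
  ∏ i, gaussianPDFReal (regMean x t β i) σ2 (y i)

/-- The spike-and-slab prior on the coefficients given the set `m` of included covariates:
independent coefficients, `N(0, V)` for the covariates in `m` and point mass at `0` otherwise. -/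
def coeffPrior (l : ℕ) {p : ℕ} (m : Finset (Fin p)) (V : ℝ≥0) :
    Measure (Fin (l + 1) → Fin p → ℝ) :=
  Measure.pi fun _ => Measure.pi fun c =>
    if c ∈ m then gaussianReal 0 V else Measure.dirac 0

/-- The marginal likelihood `L(y | M)` of the model `M` with change points `t` and covariates
`m`. -/
def marginal {l n p : ℕ} (x : Fin n → Fin p → ℝ) (σ2 V : ℝ≥0) (t : Fin l → ℝ)
    (m : Finset (Fin p)) (y : Fin n → ℝ) : ℝ :=
  ∫ β, likelihood x t σ2 y β ∂(coeffPrior l m V)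

/-- The Bayes factor of the model `(t, m)` against the model `(t', m')`. -/
def bayesFactor {l l' n p : ℕ} (x : Fin n → Fin p → ℝ) (σ2 V : ℝ≥0) (t : Fin l → ℝ)
    (m : Finset (Fin p)) (t' : Fin l' → ℝ) (m' : Finset (Fin p)) (y : Fin n → ℝ) : ℝ :=
  marginal x σ2 V t m y / marginal x σ2 V t' m' y

open Classical in
/-- The covariate combination of a coefficient array: the covariates with a nonzero coefficient
in at least one segment. -/
def activeSet {l p : ℕ} (β : Fin (l + 1) → Fin p → ℝ) : Finset (Fin p) :=
  Finset.univ.filter fun c => ∃ j, β j c ≠ 0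

/-- The locations `t` of change points are ordered and lie strictly between `0` and `1`. -/
def IsLocation {l : ℕ} (t : Fin l → ℝ) : Prop :=
  StrictMono t ∧ ∀ k, 0 < t k ∧ t k < 1

/-- The design matrix of the observations in `P` and the covariates in `S`. -/
def design {n p : ℕ} (x : Fin n → Fin p → ℝ) (P : Finset (Fin n)) (S : Finset (Fin p)) :
    Matrix P S ℝ :=
  Matrix.of fun i c => x i c

/-- `X'X` for the design matrix `X` of the observations in `P` and the covariates in `S`. -/
def gram {n p : ℕ} (x : Fin n → Fin p → ℝ) (P : Finset (Fin n)) (S : Finset (Fin p)) :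
    Matrix S S ℝ :=
  (design x P S).transpose * design x P S

/-- All singular values of the square matrix `M` lie strictly between `lo` and `hi`. -/
def SingularValuesIn {ι : Type*} [Fintype ι] [DecidableEq ι] (M : Matrix ι ι ℝ) (lo hi : ℝ) :
    Prop :=
  ∀ r < Fintype.card ι,
    lo < (Matrix.toEuclideanLin M).singularValues r ∧
      (Matrix.toEuclideanLin M).singularValues r < hi

/-- The design condition, with constants `a, b`, for the covariate sets `S n`: for all disjoint
blocks `P n 0, …, P n (k-1)` of consecutive observations, with sizes `n_i → ∞` and `q_n / n_i → 0`,
eventually the singular values of `X_i' X_i` lie in `(a n_i, b n_i)` and those of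
`(∑ j, X_j' X_j)⁻¹ X_i' X_i` lie in `(a n_i / ∑ n_j, b n_i / ∑ n_j)`. -/
def DesignCondition {p : ℕ → ℕ} (x : ∀ n, Fin n → Fin (p n) → ℝ) (q : ℕ → ℕ)
    (S : ∀ n, Finset (Fin (p n))) (a b : ℝ) : Prop :=
  ∀ (k : ℕ) (P : ∀ n, Fin k → Finset (Fin n)),
    (∀ n i, Set.OrdConnected (P n i : Set (Fin n))) →
    (∀ n i j, i ≠ j → Disjoint (P n i) (P n j)) →
    (∀ i, Tendsto (fun n => (P n i).card) atTop atTop) →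
    (∀ i, Tendsto (fun n => (q n : ℝ) / ((P n i).card : ℝ)) atTop (𝓝 0)) →
    ∀ᶠ n in atTop, ∀ i,
      SingularValuesIn (gram (x n) (P n i) (S n))
        (a * (P n i).card) (b * (P n i).card) ∧
      SingularValuesIn ((∑ j, gram (x n) (P n j) (S n))⁻¹ * gram (x n) (P n i) (S n))
        (a * ((P n i).card / ∑ j, ((P n j).card : ℝ)))
        (b * ((P n i).card / ∑ j, ((P n j).card : ℝ)))

/-- The growth conditions on the maximal number `q n` of covariates and the separation `ε n`. -/
def RateCondition (q : ℕ → ℕ) (ε : ℕ → ℝ) : Prop :=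
  Tendsto ε atTop (𝓝 0) ∧
  Tendsto (fun n : ℕ => (n : ℝ) * ε n) atTop atTop ∧
  Tendsto (fun n : ℕ => ((q n : ℝ) * Real.log n) ^ 2 / ((n : ℝ) * ε n)) atTop (𝓝 0) ∧
  ∃ c < (1 / 2 : ℝ), ∃ K : ℝ, ∀ᶠ n : ℕ in atTop, (q n : ℝ) ^ 2 ≤ K * (n : ℝ) ^ c

end ChangePoint

end

/-!
Write `e` for the noise and, for coefficients `β`, write `Δ` for the difference between the
regression function of `β` in the model `(t, m)` and the true one. Relative to the true density, the
likelihood of `β` is `exp ((⟨e, Δ⟩ - ‖Δ‖² / 2) / σ²)` (`likelihood_eq_mul_exp`). No marginal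
likelihood has to be computed; it suffices to bound both of them relative to the true density.

*The alternative model.* All the `Δ` lie in one subspace of dimension at most `(l + 1) * |m| + 1`,
so `⟨e, Δ⟩ ≤ Q + ‖Δ‖² / 4`, where `Q` is the squared norm of the projection of `e` onto this
subspace, with mean at most `σ²` times the dimension (`exists_noise_bound`). Hence the marginal
likelihood is exponentially small in `min ‖Δ‖²`, as soon as the latter dominates the dimension
(`measure_lt_marginal_le`). For the size of `‖Δ‖²`: if `t` is farther than `ε` from the true
locations, some true location has no `t i` within `ε` (`exists_forall_lt_abs_sub`). One segment of
`t` then contains a block of about `n ε` observations on either side of this location, and the two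
true coefficient vectors there, which differ, are fitted by a single vector. The lower bound for the
singular values on both blocks gives `‖Δ‖² ≥ a δ n ε / 4` for large `n`
(`half_mul_le_sum_regMean_sub_sq`, `eventually_le_sum_regMean_sub_sq`).

*The true model.* On a box of radius `n⁻³` around the true coefficients the likelihood varies by a
bounded factor only, and the prior mass of the box is at least `(κ n⁻³) ^ ((l + 1) q)`. So the
marginal likelihood is at least `exp (- C q log n)` times the true density
(`measure_marginal_lt_le`).

Since `q log n = o(n ε)`, the Bayes factor tends to `0` in probability
(`tendstoInMeasure_bayesFactor`).
-/

namespace ChangePoint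

/-! ### Singular values and quadratic forms -/

/-- For a positive operator the singular values are the eigenvalues, so a lower bound for the
former is a lower bound for the quadratic form. -/
lemma mul_norm_sq_le_inner_of_lt_singularValues {E : Type*} [NormedAddCommGroup E]
    [InnerProductSpace ℝ E] [FiniteDimensional ℝ E] {T : E →ₗ[ℝ] E} (hT : T.IsPositive) {lo : ℝ}
    (h : ∀ r < Module.finrank ℝ E, lo < T.singularValues r) (v : E) :
    lo * ‖v‖ ^ 2 ≤ inner ℝ (T v) v := by
  have hs := hT.isSymmetric
  set b := hs.eigenvectorBasis rfl
  have hev : ∀ i, lo ≤ hs.eigenvalues rfl i := by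
    intro i
    have hb : T (b i) = hs.eigenvalues rfl i • b i := hs.apply_eigenvectorBasis rfl i
    have h0 : b i ≠ 0 := b.orthonormal.ne_zero i
    have hadj : LinearMap.adjoint T = T := hT.adjoint_eq
    have hE : Module.End.HasEigenvalue (LinearMap.adjoint T ∘ₗ T) (hs.eigenvalues rfl i ^ 2) := by
      apply Module.End.hasEigenvalue_of_hasEigenvector (x := b i)
      refine ⟨Module.End.mem_eigenspace_iff.2 ?_, h0⟩
      rw [hadj, LinearMap.comp_apply, hb, map_smul, hb, smul_smul, sq]
    obtain ⟨r, hr⟩ := T.isSymmetric_adjoint_comp_self.exists_eigenvalues_eq rfl hE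
    have h1 := T.sq_singularValues_fin rfl r
    have h2 : T.singularValues r ^ 2 = hs.eigenvalues rfl i ^ 2 := by
      rw [h1]; exact_mod_cast hr
    have h3 : T.singularValues r = hs.eigenvalues rfl i :=
      (pow_left_inj₀ (T.singularValues_nonneg r) (hT.nonneg_eigenvalues rfl i) two_ne_zero).1 h2
    exact h3 ▸ (h r r.2).le
  have hin : inner ℝ (T v) v = ∑ i, hs.eigenvalues rfl i * inner ℝ (b i) v ^ 2 := by
    rw [← b.sum_inner_mul_inner (T v) v]
    refine Finset.sum_congr rfl fun i _ => ?_
    rw [hs v (b i), hs.apply_eigenvectorBasis rfl i]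
    simp only [RCLike.ofReal_real_eq_id, id, inner_smul_right, real_inner_comm v]
    ring
  rw [hin, ← b.sum_sq_norm_inner_right v, Finset.mul_sum]
  refine Finset.sum_le_sum fun i _ => ?_
  rw [Real.norm_eq_abs, sq_abs]
  exact mul_le_mul_of_nonneg_right (hev i) (sq_nonneg _)

lemma mul_sum_sq_le_sum_sq_of_singularValuesIn {n p : ℕ} {x : Fin n → Fin p → ℝ}
    {B : Finset (Fin n)} {S : Finset (Fin p)} {lo hi : ℝ}
    (h : SingularValuesIn (gram x B S) lo hi) {u : Fin p → ℝ} (hu : ∀ c ∉ S, u c = 0) :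
    lo * ∑ c, u c ^ 2 ≤ ∑ i ∈ B, (∑ c, x i c * u c) ^ 2 := by
  have hpos : (gram x B S).PosSemidef := by
    have := Matrix.posSemidef_conjTranspose_mul_self (design x B S)
    rwa [Matrix.conjTranspose_eq_transpose_of_trivial] at this
  have hT : (Matrix.toEuclideanLin (gram x B S)).IsPositive :=
    Matrix.isPositive_toEuclideanLin_iff.2 hpos
  have key := mul_norm_sq_le_inner_of_lt_singularValues hT (lo := lo)
    (fun r hr => (h r (by simpa using hr)).1) (WithLp.toLp 2 fun c : S => u c)
  have hsum : ∀ f : Fin p → ℝ, ∑ c, f c * u c = ∑ c : S, f c * u c := by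
    intro f
    rw [Finset.sum_coe_sort S (fun c => f c * u c)]
    exact (Finset.sum_subset (Finset.subset_univ S) fun c _ hc => by rw [hu c hc, mul_zero]).symm
  have h1 : ‖(WithLp.toLp 2 fun c : S => u c : EuclideanSpace ℝ S)‖ ^ 2 = ∑ c, u c ^ 2 := by
    rw [EuclideanSpace.real_norm_sq_eq]
    simp only [sq]
    exact (hsum u).symm
  have h2 : inner ℝ (Matrix.toEuclideanLin (gram x B S) (WithLp.toLp 2 fun c : S => u c))
      (WithLp.toLp 2 fun c : S => u c) = ∑ i ∈ B, (∑ c, x i c * u c) ^ 2 := by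
    rw [← Finset.sum_coe_sort B]
    simp only [hsum, gram, Matrix.toLpLin_apply, EuclideanSpace.inner_toLp_toLp]
    rw [← Matrix.mulVec_mulVec]
    simp only [star_trivial]
    rw [Matrix.dotProduct_mulVec, Matrix.vecMul_transpose]
    simp [dotProduct, Matrix.mulVec, design, sq]
  rwa [h1, h2] at key

/-! ### Gaussian noise and its projections -/

section Noise

variable {n : ℕ} (μ : Fin n → ℝ) (σ2 : ℝ≥0)

lemma memLp_noise (v : Fin n → ℝ) :
    MemLp (fun y : Fin n → ℝ => ∑ i, v i * (y i - μ i)) 2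
      (Measure.pi fun i => gaussianReal (μ i) σ2) := by
  refine memLp_finsetSum _ fun i _ => ?_
  have h : MemLp (fun z : ℝ => v i * (z - μ i)) 2 (gaussianReal (μ i) σ2) :=
    ((memLp_id_gaussianReal 2).sub (memLp_const _)).const_mul _
  exact h.comp_measurePreserving (measurePreserving_eval _ i)

lemma integral_noise_sq (v : Fin n → ℝ) :
    ∫ y : Fin n → ℝ, (∑ i, v i * (y i - μ i)) ^ 2 ∂(Measure.pi fun i => gaussianReal (μ i) σ2)
      = σ2 * ∑ i, v i ^ 2 := by
  have hL : ∀ i, MemLp (fun z : ℝ => v i * (z - μ i)) 2 (gaussianReal (μ i) σ2) := fun i =>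
    ((memLp_id_gaussianReal 2).sub (memLp_const _)).const_mul _
  have hvar := variance_sum_pi (μ := fun i => gaussianReal (μ i) σ2)
    (X := fun i z => v i * (z - μ i)) hL
  have h0 : ∫ y : Fin n → ℝ, (∑ i, fun y : Fin n → ℝ => v i * (y i - μ i)) y
      ∂(Measure.pi fun i => gaussianReal (μ i) σ2) = 0 := by
    simp only [Finset.sum_apply]
    rw [integral_finsetSum]
    · refine Finset.sum_eq_zero fun i _ => ?_
      rw [integral_comp_eval (μ := fun i => gaussianReal (μ i) σ2)
        (f := fun z => v i * (z - μ i)) (hL i).aestronglyMeasurable, integral_const_mul,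
        integral_sub (f := fun z : ℝ => z) ((memLp_id_gaussianReal 1).integrable le_rfl)
        (integrable_const _)]
      simp
    · intro i _
      exact ((hL i).comp_measurePreserving (measurePreserving_eval _ i)).integrable one_le_two
  rw [variance_of_integral_eq_zero _ h0] at hvar
  · simp only [Finset.sum_apply] at hvar
    rw [hvar, Finset.mul_sum]
    refine Finset.sum_congr rfl fun i _ => ?_
    rw [variance_const_mul, variance_sub_const (X := fun z : ℝ => z) aestronglyMeasurable_id,
      variance_fun_id_gaussianReal, mul_comm]
  · exact (memLp_noise μ σ2 v).aestronglyMeasurable.aemeasurable.congr (by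
      filter_upwards with y; simp)

/-- The squared norm `Q` of the projection of the noise onto a subspace `W` is at most `s`, up to
probability `σ2 * dim W / s`; it controls the inner products of the noise with all of `W` at
once. -/
lemma exists_noise_bound (W : Submodule ℝ (EuclideanSpace ℝ (Fin n))) {s : ℝ} (hs : 0 < s) :
    ∃ Q : (Fin n → ℝ) → ℝ, (∀ y, 0 ≤ Q y) ∧
      (∀ y, ∀ w ∈ W, (∑ i, w i * (y i - μ i)) ^ 2 ≤ Q y * ∑ i, w i ^ 2) ∧
      (Measure.pi fun i => gaussianReal (μ i) σ2) {y | s ≤ Q y}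
        ≤ ENNReal.ofReal (σ2 * Module.finrank ℝ W / s) := by
  set b := stdOrthonormalBasis ℝ W
  refine ⟨fun y => ∑ k, (∑ i, (b k : EuclideanSpace ℝ (Fin n)) i * (y i - μ i)) ^ 2,
    fun y => Finset.sum_nonneg fun _ _ => sq_nonneg _, fun y w hw => ?_, ?_⟩
  · have hin : ∀ w' : EuclideanSpace ℝ (Fin n), ∑ i, w' i * (y i - μ i)
        = inner ℝ w' (WithLp.toLp 2 fun i => y i - μ i) := by
      intro w'
      simp [PiLp.inner_apply, mul_comm]
    have hrep : (w : EuclideanSpace ℝ (Fin n))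
        = ∑ k, inner ℝ (b k) (⟨w, hw⟩ : W) • (b k : EuclideanSpace ℝ (Fin n)) := by
      have := congrArg (Subtype.val) (b.sum_repr' ⟨w, hw⟩)
      simpa using this.symm
    have hn : ∑ i, w i ^ 2 = ∑ k, inner ℝ (b k) (⟨w, hw⟩ : W) ^ 2 := by
      rw [← EuclideanSpace.real_norm_sq_eq]
      have := b.sum_sq_norm_inner_right ⟨w, hw⟩
      simp only [Real.norm_eq_abs, sq_abs] at this
      rw [this]; rfl
    simp only [hin]
    conv_lhs => rw [hrep, sum_inner]
    simp only [real_inner_smul_left]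
    rw [hn, mul_comm]
    exact Finset.sum_mul_sq_le_sq_mul_sq _ _ _
  · set ν := Measure.pi fun i => gaussianReal (μ i) σ2
    have hint : ∀ k, Integrable (fun y : Fin n → ℝ =>
        (∑ i, (b k : EuclideanSpace ℝ (Fin n)) i * (y i - μ i)) ^ 2) ν := fun k =>
      (memLp_noise μ σ2 _).integrable_sq
    have hE : ∫ y, ∑ k, (∑ i, (b k : EuclideanSpace ℝ (Fin n)) i * (y i - μ i)) ^ 2 ∂ν
        = σ2 * Module.finrank ℝ W := by
      rw [integral_finsetSum _ fun k _ => hint k]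
      have : ∀ k, ∑ i, (b k : EuclideanSpace ℝ (Fin n)) i ^ 2 = 1 := by
        intro k
        rw [← EuclideanSpace.real_norm_sq_eq]
        have := b.orthonormal.1 k
        rw [Submodule.coe_norm] at *
        rw [this, one_pow]
      simp only [ν, integral_noise_sq, this]
      simp [mul_comm]
    have hM := mul_meas_ge_le_integral_of_nonneg (μ := ν)
      (f := fun y => ∑ k, (∑ i, (b k : EuclideanSpace ℝ (Fin n)) i * (y i - μ i)) ^ 2)
      (Eventually.of_forall fun y => Finset.sum_nonneg fun _ _ => sq_nonneg _)
      (integrable_finsetSum _ fun k _ => hint k) s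
    rw [hE] at hM
    rw [← ENNReal.ofReal_toReal (measure_ne_top ν _)]
    refine ENNReal.ofReal_le_ofReal ?_
    rw [le_div_iff₀ hs, mul_comm]
    exact hM

end Noise

/-! ### Likelihood and prior -/

section Likelihood

variable {l n p : ℕ} (x : Fin n → Fin p → ℝ) (t : Fin l → ℝ) (σ2 : ℝ≥0)

/-- The likelihood relative to the one of an arbitrary mean vector `μ`. -/
lemma likelihood_eq_mul_exp (hσ2 : 0 < σ2) (μ : Fin n → ℝ) (y : Fin n → ℝ)
    (β : Fin (l + 1) → Fin p → ℝ) :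
    likelihood x t σ2 y β = (∏ i, gaussianPDFReal (μ i) σ2 (y i)) *
      Real.exp ((∑ i, (regMean x t β i - μ i) * (y i - μ i)
        - (∑ i, (regMean x t β i - μ i) ^ 2) / 2) / σ2) := by
  have hσ : (σ2 : ℝ) ≠ 0 := by exact_mod_cast hσ2.ne'
  rw [Finset.sum_div, ← Finset.sum_sub_distrib, Finset.sum_div, Real.exp_sum,
    ← Finset.prod_mul_distrib, likelihood]
  refine Finset.prod_congr rfl fun i _ => ?_
  simp only [gaussianPDFReal]
  rw [mul_assoc (_)⁻¹, ← Real.exp_add]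
  congr 2
  field_simp
  ring

lemma likelihood_nonneg (y : Fin n → ℝ) (β : Fin (l + 1) → Fin p → ℝ) :
    0 ≤ likelihood x t σ2 y β :=
  Finset.prod_nonneg fun _ _ => gaussianPDFReal_nonneg _ _ _

instance isProbabilityMeasure_coeffPrior (m : Finset (Fin p)) (V : ℝ≥0) :
    IsProbabilityMeasure (coeffPrior l m V) := by
  have : ∀ c : Fin p, IsProbabilityMeasure
      (if c ∈ m then gaussianReal 0 V else Measure.dirac 0) := fun c => by
    split_ifs <;> infer_instance
  unfold coeffPrior
  infer_instance

lemma integrable_likelihood (y : Fin n → ℝ) (m : Finset (Fin p)) (V : ℝ≥0) :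
    Integrable (likelihood x t σ2 y) (coeffPrior l m V) := by
  refine Integrable.of_bound (C := ∏ _i : Fin n, (√(2 * Real.pi * σ2))⁻¹) ?_ ?_
  · refine Measurable.aestronglyMeasurable ?_
    unfold likelihood regMean gaussianPDFReal
    fun_prop
  · refine Eventually.of_forall fun β => ?_
    rw [Real.norm_of_nonneg (likelihood_nonneg x t σ2 y β)]
    refine Finset.prod_le_prod (fun _ _ => gaussianPDFReal_nonneg _ _ _) fun i _ => ?_
    refine mul_le_of_le_one_right (by positivity) (Real.exp_le_one_iff.2 ?_)
    rw [neg_div]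
    exact neg_nonpos.2 (by positivity)

lemma ae_coeffPrior_eq_zero (m : Finset (Fin p)) (V : ℝ≥0) :
    ∀ᵐ β ∂(coeffPrior l m V), ∀ j, ∀ c ∉ m, β j c = 0 := by
  have : ∀ c : Fin p, IsProbabilityMeasure
      (if c ∈ m then gaussianReal 0 V else Measure.dirac 0) := fun c => by
    split_ifs <;> infer_instance
  rw [ae_all_iff]; intro j
  rw [ae_all_iff]; intro c
  by_cases hc : c ∈ m
  · exact Eventually.of_forall fun β h => absurd hc h
  have h1 : ∀ᵐ z ∂(if c ∈ m then gaussianReal 0 V else Measure.dirac (0 : ℝ)), z = 0 := by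
    rw [if_neg hc]
    exact (ae_dirac_iff (measurableSet_eq)).2 rfl
  have h2 := (Measure.quasiMeasurePreserving_eval
    (μ := fun c : Fin p => if c ∈ m then gaussianReal 0 V else Measure.dirac (0 : ℝ)) c).ae h1
  have h3 := (Measure.quasiMeasurePreserving_eval (μ := fun _ : Fin (l + 1) =>
    Measure.pi fun c : Fin p => if c ∈ m then gaussianReal 0 V else Measure.dirac (0 : ℝ)) j).ae h2
  filter_upwards [h3] with β h _ using h

lemma marginal_le {y : Fin n → ℝ} {m : Finset (Fin p)} {V : ℝ≥0} {C : ℝ}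
    (h : ∀ β : Fin (l + 1) → Fin p → ℝ, (∀ j, ∀ c ∉ m, β j c = 0) → likelihood x t σ2 y β ≤ C) :
    marginal x σ2 V t m y ≤ C := by
  calc marginal x σ2 V t m y ≤ ∫ _, C ∂(coeffPrior l m V) := by
        refine integral_mono_ae (integrable_likelihood x t σ2 y m V) (integrable_const _) ?_
        filter_upwards [ae_coeffPrior_eq_zero m V] with β hβ using h β hβ
    _ = C := by simp

/-- The coefficient arrays within distance `r` of `β₀` on `m`, and equal to `0` off `m`. -/
def coeffBox (m : Finset (Fin p)) (β₀ : Fin (l + 1) → Fin p → ℝ) (r : ℝ) :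
    Set (Fin (l + 1) → Fin p → ℝ) :=
  Set.univ.pi fun j => Set.univ.pi fun c =>
    if c ∈ m then Set.Icc (β₀ j c - r) (β₀ j c + r) else {0}

lemma measurableSet_coeffBox (m : Finset (Fin p)) (β₀ : Fin (l + 1) → Fin p → ℝ) (r : ℝ) :
    MeasurableSet (coeffBox m β₀ r) := by
  refine MeasurableSet.univ_pi fun j => MeasurableSet.univ_pi fun c => ?_
  split_ifs
  · exact measurableSet_Icc
  · exact measurableSet_singleton _

lemma mul_measure_coeffBox_le_marginal {y : Fin n → ℝ} {m : Finset (Fin p)} {V : ℝ≥0} {C r : ℝ}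
    {β₀ : Fin (l + 1) → Fin p → ℝ} (h : ∀ β ∈ coeffBox m β₀ r, C ≤ likelihood x t σ2 y β) :
    C * (coeffPrior l m V).real (coeffBox m β₀ r) ≤ marginal x σ2 V t m y := by
  calc C * (coeffPrior l m V).real (coeffBox m β₀ r)
      = ∫ _ in coeffBox m β₀ r, C ∂(coeffPrior l m V) := by simp [mul_comm]
    _ ≤ ∫ β in coeffBox m β₀ r, likelihood x t σ2 y β ∂(coeffPrior l m V) :=
        setIntegral_mono_on (integrable_const _).integrableOn
          (integrable_likelihood x t σ2 y m V).integrableOn (measurableSet_coeffBox m β₀ r) h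
    _ ≤ marginal x σ2 V t m y :=
        setIntegral_le_integral (integrable_likelihood x t σ2 y m V)
          (Eventually.of_forall fun β => likelihood_nonneg x t σ2 y β)

end Likelihood

lemma mul_le_gaussianReal_Icc {V : ℝ≥0} (hV : V ≠ 0) {κ K z r : ℝ} (hr : 0 < r) (hr1 : r ≤ 1)
    (hκ0 : 0 ≤ κ) (hκ : ∀ w, |w| ≤ K + 1 → κ ≤ gaussianPDFReal 0 V w) (hz : |z| ≤ K) :
    κ * r ≤ (gaussianReal 0 V).real (Set.Icc (z - r) (z + r)) := by
  have h := gaussianReal_apply_eq_integral 0 hV (Set.Icc (z - r) (z + r))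
  have h' : (gaussianReal 0 V).real (Set.Icc (z - r) (z + r))
      = ∫ w in Set.Icc (z - r) (z + r), gaussianPDFReal 0 V w := by
    rw [Measure.real, h, ENNReal.toReal_ofReal]
    exact integral_nonneg fun _ => gaussianPDFReal_nonneg _ _ _
  rw [h']
  calc κ * r ≤ κ * (2 * r) := by nlinarith
    _ = ∫ w in Set.Icc (z - r) (z + r), κ := by
        rw [setIntegral_const, Real.volume_real_Icc_of_le (by linarith), smul_eq_mul]; ring
    _ ≤ _ := by
        refine setIntegral_mono_on (integrableOn_const (by simp))
          (integrable_gaussianPDFReal 0 V).integrableOn measurableSet_Icc fun w hw => hκ w ?_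
        have := abs_le.1 hz
        exact abs_le.2 ⟨by linarith [hw.1, this.1], by linarith [hw.2, this.2]⟩

lemma pow_le_coeffPrior_coeffBox {l p : ℕ} {m : Finset (Fin p)} {V : ℝ≥0} (hV : V ≠ 0)
    {κ K r : ℝ} (hr : 0 < r) (hr1 : r ≤ 1)
    (hκ0 : 0 ≤ κ) (hκ : ∀ w, |w| ≤ K + 1 → κ ≤ gaussianPDFReal 0 V w)
    {β₀ : Fin (l + 1) → Fin p → ℝ} (hβ₀ : ∀ j c, |β₀ j c| ≤ K) :
    (κ * r) ^ ((l + 1) * m.card) ≤ (coeffPrior l m V).real (coeffBox m β₀ r) := by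
  have : ∀ c : Fin p, IsProbabilityMeasure
      (if c ∈ m then gaussianReal 0 V else Measure.dirac 0) := fun c => by
    split_ifs <;> infer_instance
  rw [Measure.real, coeffPrior, coeffBox, Measure.pi_pi, ENNReal.toReal_prod]
  have hj : ∀ j : Fin (l + 1), (κ * r) ^ m.card ≤ ((Measure.pi fun c =>
      if c ∈ m then gaussianReal 0 V else Measure.dirac (0 : ℝ)) (Set.univ.pi fun c =>
        if c ∈ m then Set.Icc (β₀ j c - r) (β₀ j c + r) else {0})).toReal := by
    intro j
    rw [Measure.pi_pi, ENNReal.toReal_prod]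
    have : (κ * r) ^ m.card = ∏ c, if c ∈ m then κ * r else 1 := by
      rw [Finset.prod_ite_mem, Finset.univ_inter, Finset.prod_const]
    rw [this]
    refine Finset.prod_le_prod (fun c _ => by split_ifs <;> positivity) fun c _ => ?_
    by_cases hc : c ∈ m
    · simp only [if_pos hc]
      exact mul_le_gaussianReal_Icc hV hr hr1 hκ0 hκ (hβ₀ j c)
    · simp [if_neg hc]
  calc (κ * r) ^ ((l + 1) * m.card) = ∏ _j : Fin (l + 1), (κ * r) ^ m.card := by
        rw [Finset.prod_const, ← pow_mul, Finset.card_univ, Fintype.card_fin, mul_comm m.card]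
    _ ≤ _ := Finset.prod_le_prod (fun _ _ => by positivity) fun j _ => hj j

lemma exists_le_gaussianPDFReal (Vlo Vhi : ℝ≥0) (hVlo : 0 < Vlo) (K : ℝ) :
    ∃ κ : ℝ, 0 < κ ∧ κ ≤ 1 ∧ ∀ V : ℝ≥0, Vlo ≤ V → V ≤ Vhi → ∀ w, |w| ≤ K →
      κ ≤ gaussianPDFReal 0 V w := by
  by_cases hlh : Vlo ≤ Vhi
  swap
  · exact ⟨1, one_pos, le_rfl, fun V h1 h2 => absurd (h1.trans h2) hlh⟩
  have hhi : (0 : ℝ) < Vhi := by exact_mod_cast hVlo.trans_le hlh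
  refine ⟨min 1 ((√(2 * Real.pi * Vhi))⁻¹ * Real.exp (-K ^ 2 / (2 * Vlo))), by positivity,
    min_le_left _ _, fun V h1 h2 w hw => (min_le_right _ _).trans ?_⟩
  have hlo' : (0 : ℝ) < Vlo := by exact_mod_cast hVlo
  have h1' : (Vlo : ℝ) ≤ V := by exact_mod_cast h1
  have h2' : (V : ℝ) ≤ Vhi := by exact_mod_cast h2
  have hV : (0 : ℝ) < V := hlo'.trans_le h1'
  have hw2 : w ^ 2 ≤ K ^ 2 := sq_le_sq' (abs_le.1 hw).1 (abs_le.1 hw).2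
  simp only [gaussianPDFReal, sub_zero]
  rw [neg_div, neg_div]
  gcongr

/-! ### Bounds for the marginal likelihoods -/

/-- The span of `μ` and of the columns of the design in the model `(t, m)`: the regression
functions of this model and their differences to `μ` lie here. -/
def predictorSpace {l n p : ℕ} (x : Fin n → Fin p → ℝ) (t : Fin l → ℝ) (m : Finset (Fin p))
    (μ : Fin n → ℝ) : Submodule ℝ (EuclideanSpace ℝ (Fin n)) :=
  Submodule.span ℝ (Set.range fun k : Option (Fin (l + 1) × m) =>
    k.elim (WithLp.toLp 2 μ) fun jc =>
      WithLp.toLp 2 fun i => if segmentIndex t n i = jc.1 then x i jc.2 else 0)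

section Marginal

variable {l n p : ℕ} (x : Fin n → Fin p → ℝ) (t : Fin l → ℝ) (m : Finset (Fin p)) (σ2 : ℝ≥0)

lemma finrank_predictorSpace_le (μ : Fin n → ℝ) :
    Module.finrank ℝ (predictorSpace x t m μ) ≤ (l + 1) * m.card + 1 := by
  refine (finrank_range_le_card _).trans ?_
  simp

lemma sub_mem_predictorSpace (μ : Fin n → ℝ) {β : Fin (l + 1) → Fin p → ℝ}
    (hβ : ∀ j, ∀ c ∉ m, β j c = 0) :
    (WithLp.toLp 2 fun i => regMean x t β i - μ i) ∈ predictorSpace x t m μ := by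
  have h0 : WithLp.toLp 2 μ ∈ predictorSpace x t m μ := Submodule.subset_span ⟨none, rfl⟩
  have h1 : ∀ jc : Fin (l + 1) × m, (WithLp.toLp 2 fun i =>
      if segmentIndex t n i = jc.1 then x i jc.2 else 0) ∈ predictorSpace x t m μ :=
    fun jc => Submodule.subset_span ⟨some jc, rfl⟩
  have h2 : (WithLp.toLp 2 fun i => regMean x t β i - μ i : EuclideanSpace ℝ (Fin n))
      = ∑ jc : Fin (l + 1) × m, β jc.1 jc.2 • (WithLp.toLp 2 fun i =>
        if segmentIndex t n i = jc.1 then x i jc.2 else 0 : EuclideanSpace ℝ (Fin n))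
        - WithLp.toLp 2 μ := by
    ext i
    simp only [PiLp.sub_apply, WithLp.ofLp_sum, Finset.sum_apply, PiLp.smul_apply, smul_eq_mul,
      Fintype.sum_prod_type, mul_ite, mul_zero]
    congr 1
    rw [Finset.sum_comm, Finset.sum_congr rfl fun c _ => Fintype.sum_ite_eq _ _,
      Finset.sum_coe_sort m (fun c => β (segmentIndex t n i) c * x i c), regMean]
    symm
    simp only [mul_comm (x i _)]
    exact Finset.sum_subset (Finset.subset_univ m) fun c _ hc => by rw [hβ _ c hc, zero_mul]
  rw [h2]
  exact Submodule.sub_mem _ (Submodule.sum_mem _ fun jc _ => Submodule.smul_mem _ _ (h1 jc)) h0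

/-- If all regression functions of the model `(t, m)` are at squared distance at least `8 s` from
the true one, then the marginal likelihood of the model is exponentially small in `s`, relative to
the true density, up to a probability proportional to the dimension of the model. -/
lemma measure_lt_marginal_le (hσ2 : 0 < σ2) (V : ℝ≥0) (μ : Fin n → ℝ) {s : ℝ} (hs : 0 < s)
    (hfar : ∀ β : Fin (l + 1) → Fin p → ℝ, (∀ j, ∀ c ∉ m, β j c = 0) →
      8 * s ≤ ∑ i, (regMean x t β i - μ i) ^ 2) :
    (Measure.pi fun i => gaussianReal (μ i) σ2)
      {y | (∏ i, gaussianPDFReal (μ i) σ2 (y i)) * Real.exp (-s / σ2) < marginal x σ2 V t m y}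
      ≤ ENNReal.ofReal (σ2 * ((l + 1) * m.card + 1) / s) := by
  obtain ⟨Q, hQ0, hQ, hQs⟩ := exists_noise_bound μ σ2 (predictorSpace x t m μ) hs
  refine (measure_mono fun y hy => ?_).trans (hQs.trans (ENNReal.ofReal_le_ofReal ?_))
  · by_contra hlt
    have hlt : Q y < s := not_le.1 hlt
    refine absurd hy (not_lt.2 (marginal_le x t σ2 fun β hβ => ?_))
    rw [likelihood_eq_mul_exp x t σ2 hσ2 μ y β]
    refine mul_le_mul_of_nonneg_left (Real.exp_le_exp.2 ?_)
      (Finset.prod_nonneg fun _ _ => gaussianPDFReal_nonneg _ _ _)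
    have h1 := hQ y _ (sub_mem_predictorSpace x t m μ hβ)
    have h2 := hfar β hβ
    simp only at h1
    set D := ∑ i, (regMean x t β i - μ i) ^ 2
    set c := ∑ i, (regMean x t β i - μ i) * (y i - μ i)
    -- `c ≤ √(Q D) ≤ Q + D / 4`
    have h3 : c ≤ Q y + D / 4 := by
      refine (abs_le_of_sq_le_sq' ?_ (by linarith [hQ0 y])).2
      nlinarith [sq_nonneg (Q y - D / 4)]
    gcongr
    linarith
  · have : (Module.finrank ℝ (predictorSpace x t m μ) : ℝ) ≤ (l + 1) * m.card + 1 := by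
      exact_mod_cast finrank_predictorSpace_le x t m μ
    gcongr

/-- The true model gives its marginal likelihood a contribution from a small box around the true
coefficients; up to small probability the likelihood hardly varies over this box. -/
lemma measure_marginal_lt_le (hσ2 : 0 < σ2) {V : ℝ≥0} (hV : V ≠ 0) {κ Kx Kβ r s A : ℝ}
    (hr : 0 < r) (hr1 : r ≤ 1) (hs : 0 < s) (hA : 0 ≤ A)
    (hκ0 : 0 < κ) (hκ : ∀ w, |w| ≤ Kβ + 1 → κ ≤ gaussianPDFReal 0 V w)
    (hx : ∀ i c, |x i c| ≤ Kx) {β₀ : Fin (l + 1) → Fin p → ℝ} (hβ₀ : ∀ j c, |β₀ j c| ≤ Kβ)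
    (hsupp : ∀ j, ∀ c ∉ m, β₀ j c = 0)
    (hA1 : n * (m.card * (Kx * r)) ^ 2 ≤ A) (hA2 : s * (n * (m.card * (Kx * r)) ^ 2) ≤ A ^ 2) :
    (dataLaw x t β₀ σ2)
      {y | marginal x σ2 V t m y < (∏ i, gaussianPDFReal (regMean x t β₀ i) σ2 (y i)) *
        Real.exp (-(2 * A) / σ2) * (κ * r) ^ ((l + 1) * m.card)}
      ≤ ENNReal.ofReal (σ2 * n / s) := by
  set μ : Fin n → ℝ := regMean x t β₀
  obtain ⟨Q, hQ0, hQ, hQs⟩ := exists_noise_bound μ σ2 ⊤ hs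
  have hn : (Module.finrank ℝ (⊤ : Submodule ℝ (EuclideanSpace ℝ (Fin n))) : ℝ) = n := by simp
  rw [hn] at hQs
  refine (measure_mono fun y hy => ?_).trans hQs
  by_contra hlt
  have hlt : Q y < s := not_le.1 hlt
  have hp : 0 ≤ ∏ i, gaussianPDFReal (μ i) σ2 (y i) :=
    Finset.prod_nonneg fun _ _ => gaussianPDFReal_nonneg _ _ _
  refine absurd hy (not_lt.2 (le_trans ?_ (mul_measure_coeffBox_le_marginal x t σ2 (β₀ := β₀)
    (r := r) (C := (∏ i, gaussianPDFReal (μ i) σ2 (y i)) * Real.exp (-(2 * A) / σ2))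
    fun β hβ => ?_)))
  · exact mul_le_mul_of_nonneg_left (pow_le_coeffPrior_coeffBox hV hr hr1 hκ0.le hκ hβ₀)
      (by positivity)
  · rw [likelihood_eq_mul_exp x t σ2 hσ2 μ y β]
    refine mul_le_mul_of_nonneg_left (Real.exp_le_exp.2 ?_) hp
    have hβ' : ∀ j c, if c ∈ m then |β j c - β₀ j c| ≤ r else β j c = 0 := by
      intro j c
      have := hβ j (Set.mem_univ j) c (Set.mem_univ c)
      split_ifs with hc <;> simp only [hc, if_true, if_false] at this
      · exact abs_le.2 ⟨by linarith [this.1], by linarith [this.2]⟩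
      · exact this
    have hd : ∀ i, |regMean x t β i - μ i| ≤ m.card * (Kx * r) := by
      intro i
      have : regMean x t β i - μ i
          = ∑ c ∈ m, x i c * (β (segmentIndex t n i) c - β₀ (segmentIndex t n i) c) := by
        simp only [μ, regMean, ← Finset.sum_sub_distrib, ← mul_sub]
        refine (Finset.sum_subset (Finset.subset_univ m) fun c _ hc => ?_).symm
        have := hβ' (segmentIndex t n i) c
        rw [if_neg hc] at this
        rw [this, hsupp _ c hc, sub_self, mul_zero]
      rw [this]
      refine (Finset.abs_sum_le_sum_abs _ _).trans ?_
      rw [← nsmul_eq_mul]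
      refine Finset.sum_le_card_nsmul _ _ _ fun c hc => ?_
      have h := hβ' (segmentIndex t n i) c
      rw [if_pos hc] at h
      rw [abs_mul]
      exact mul_le_mul (hx i c) h (abs_nonneg _) ((abs_nonneg _).trans (hx i c))
    have hD : ∑ i, (regMean x t β i - μ i) ^ 2 ≤ n * (m.card * (Kx * r)) ^ 2 := by
      refine (Finset.sum_le_card_nsmul _ _ ((m.card * (Kx * r)) ^ 2) fun i _ => ?_).trans
        (by simp)
      rw [← sq_abs]
      exact pow_le_pow_left₀ (abs_nonneg _) (hd i) 2
    have h1 := hQ y (WithLp.toLp 2 fun i => regMean x t β i - μ i) trivial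
    simp only at h1
    have hD0 : 0 ≤ ∑ i, (regMean x t β i - μ i) ^ 2 := Finset.sum_nonneg fun _ _ => sq_nonneg _
    set D := ∑ i, (regMean x t β i - μ i) ^ 2
    set c := ∑ i, (regMean x t β i - μ i) * (y i - μ i)
    have h3 : -A ≤ c := by
      refine (abs_le_of_sq_le_sq' (h1.trans (le_trans ?_ hA2)) hA).1
      exact mul_le_mul hlt.le hD hD0 hs.le
    gcongr
    linarith

end Marginal

/-- Non-asymptotic bound for the probability that the Bayes factor is not small: `s` measures the
misfit of the model `(t, m)`, and `(κ * r) ^ _` bounds from below the prior mass of a box of radius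
`r` around the true coefficients. -/
lemma measure_le_norm_bayesFactor_le {l n p : ℕ} (x : Fin n → Fin p → ℝ) (t t₀ : Fin l → ℝ)
    (m m₀ : Finset (Fin p)) {σ2 : ℝ≥0} (hσ2 : 0 < σ2) {V : ℝ≥0} (hV : V ≠ 0)
    {κ Kx Kβ r s s' A η : ℝ}
    (hr : 0 < r) (hr1 : r ≤ 1) (hs : 0 < s) (hs' : 0 < s') (hA : 0 ≤ A)
    (hκ0 : 0 < κ) (hκ : ∀ w, |w| ≤ Kβ + 1 → κ ≤ gaussianPDFReal 0 V w)
    (hx : ∀ i c, |x i c| ≤ Kx) {β₀ : Fin (l + 1) → Fin p → ℝ} (hβ₀ : ∀ j c, |β₀ j c| ≤ Kβ)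
    (hsupp : ∀ j, ∀ c ∉ m₀, β₀ j c = 0)
    (hA1 : n * (m₀.card * (Kx * r)) ^ 2 ≤ A) (hA2 : s' * (n * (m₀.card * (Kx * r)) ^ 2) ≤ A ^ 2)
    (hfar : ∀ β : Fin (l + 1) → Fin p → ℝ, (∀ j, ∀ c ∉ m, β j c = 0) →
      8 * s ≤ ∑ i, (regMean x t β i - regMean x t₀ β₀ i) ^ 2)
    (hη : Real.exp (-s / σ2) < η * (Real.exp (-(2 * A) / σ2) * (κ * r) ^ ((l + 1) * m₀.card))) :
    (dataLaw x t₀ β₀ σ2) {y | η ≤ ‖bayesFactor x σ2 V t m t₀ m₀ y‖}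
      ≤ ENNReal.ofReal (σ2 * ((l + 1) * m.card + 1) / s) + ENNReal.ofReal (σ2 * n / s') := by
  refine le_trans ?_ (add_le_add (measure_lt_marginal_le x t m σ2 hσ2 V _ hs hfar)
    (measure_marginal_lt_le x t₀ m₀ σ2 hσ2 hV hr hr1 hs' hA hκ0 hκ hx hβ₀ hsupp hA1 hA2))
  refine (measure_mono fun y hy => ?_).trans (measure_union_le _ _)
  by_contra hnot
  simp only [Set.mem_union, Set.mem_ofPred_eq, not_or, not_lt] at hnot
  obtain ⟨h1, h2⟩ := hnot
  have hp : 0 < ∏ i, gaussianPDFReal (regMean x t₀ β₀ i) σ2 (y i) :=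
    Finset.prod_pos fun _ _ => gaussianPDFReal_pos _ _ _ hσ2.ne'
  set pd := ∏ i, gaussianPDFReal (regMean x t₀ β₀ i) σ2 (y i)
  have hpos : 0 < marginal x σ2 V t₀ m₀ y := lt_of_lt_of_le (by positivity) h2
  have hnn : 0 ≤ marginal x σ2 V t m y := integral_nonneg fun β => likelihood_nonneg x t σ2 y β
  have hη0 : 0 < η := by
    by_contra h
    have : 0 < Real.exp (-(2 * A) / σ2) * (κ * r) ^ ((l + 1) * m₀.card) := by positivity
    have := mul_nonpos_of_nonpos_of_nonneg (not_lt.1 h) this.le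
    linarith [Real.exp_pos (-s / σ2)]
  refine absurd (show η ≤ ‖bayesFactor x σ2 V t m t₀ m₀ y‖ from hy) (not_le.2 ?_)
  rw [bayesFactor, Real.norm_of_nonneg (div_nonneg hnn hpos.le), div_lt_iff₀ hpos]
  calc marginal x σ2 V t m y ≤ pd * Real.exp (-s / σ2) := h1
    _ < pd * (η * (Real.exp (-(2 * A) / σ2) * (κ * r) ^ ((l + 1) * m₀.card))) :=
        mul_lt_mul_of_pos_left hη hp
    _ = η * (pd * Real.exp (-(2 * A) / σ2) * (κ * r) ^ ((l + 1) * m₀.card)) := by ring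
    _ ≤ _ := mul_le_mul_of_nonneg_left h2 hη0.le

/-! ### Segments and blocks -/

/-- If ordered locations are not within `ε` of the true ones index by index, then some true
location has none of them within `ε`: otherwise matching each true location with a near one would
be a strictly monotone self-map of `Fin l`, hence the identity. -/
lemma exists_forall_lt_abs_sub {l : ℕ} {t t₀ : Fin l → ℝ} (ht : StrictMono t) {ε : ℝ}
    (hε : ∀ i j, i < j → 2 * ε < t₀ j - t₀ i) (h : ∃ k, ε < |t k - t₀ k|) :
    ∃ j, ∀ i, ε < |t i - t₀ j| := by
  by_contra! hcon
  choose f hf using hcon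
  have hmono : StrictMono f := by
    intro i j hij
    have h1 := abs_le.1 (hf i)
    have h2 := abs_le.1 (hf j)
    have h3 := hε i j hij
    exact ht.lt_iff_lt.1 (by linarith [h1.2, h2.1])
  obtain ⟨k, hk⟩ := h
  have hid : f k = k := le_antisymm (hmono.apply_le) (hmono.le_apply)
  have := hf k
  rw [hid] at this
  linarith

lemma segmentIndex_val_eq_card {l n : ℕ} {t : Fin l → ℝ} {i : Fin n} {A : Finset (Fin l)}
    (h : ∀ k, (n : ℝ) * t k < (i : ℝ) + 1 ↔ k ∈ A) : (segmentIndex t n i : ℕ) = A.card := by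
  simp only [segmentIndex]
  congr 1
  ext k
  simp [h]

/-- The observations with (1-based) time index in the interval `(u, v]`. -/
noncomputable def block (n : ℕ) (u v : ℝ) : Finset (Fin n) :=
  Finset.univ.filter fun i => u < (i : ℝ) + 1 ∧ (i : ℝ) + 1 ≤ v

lemma mem_block {n : ℕ} {u v : ℝ} {i : Fin n} :
    i ∈ block n u v ↔ u < (i : ℝ) + 1 ∧ (i : ℝ) + 1 ≤ v := by simp [block]

lemma ordConnected_block (n : ℕ) (u v : ℝ) : Set.OrdConnected (block n u v : Set (Fin n)) := by
  refine ⟨fun i hi j hj k hk => ?_⟩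
  rw [Finset.mem_coe, mem_block] at *
  have h1 : (i : ℝ) ≤ k := by exact_mod_cast hk.1
  have h2 : (k : ℝ) ≤ j := by exact_mod_cast hk.2
  exact ⟨by linarith [hi.1], by linarith [hj.2]⟩

lemma le_card_block {n : ℕ} {u v : ℝ} (hu : 0 ≤ u) (huv : u ≤ v) (hv : v ≤ n) :
    v - u - 1 ≤ (block n u v).card := by
  have hsurj : Set.SurjOn (fun i : Fin n => (i : ℕ) + 1) (block n u v)
      (Finset.Ioc ⌊u⌋₊ ⌊v⌋₊ : Finset ℕ) := by
    intro k hk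
    rw [Finset.mem_coe, Finset.mem_Ioc, Nat.floor_lt hu, Nat.le_floor_iff (hu.trans huv)] at hk
    have hk1 : 1 ≤ k := by
      have : (0 : ℝ) < k := hu.trans_lt hk.1
      exact_mod_cast this
    have hkn : k ≤ n := by exact_mod_cast hk.2.trans hv
    refine ⟨⟨k - 1, by omega⟩, ?_, by simp; omega⟩
    rw [Finset.mem_coe, mem_block]
    simpa [Nat.cast_sub hk1] using hk
  have h1 := Finset.card_le_card_of_surjOn _ hsurj
  rw [Nat.card_Ioc, tsub_le_iff_right] at h1
  have h2 : (⌊v⌋₊ : ℝ) ≤ (block n u v).card + ⌊u⌋₊ := by exact_mod_cast h1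
  linarith [Nat.lt_floor_add_one v, Nat.floor_le hu]

/-- A model without a change point within `ε` of the true location `t₀ j` has to fit both sides of
this location with one coefficient vector, and one of the two fits is bad. -/
lemma half_mul_le_sum_regMean_sub_sq {l n p : ℕ} {x : Fin n → Fin p → ℝ} {t t₀ : Fin l → ℝ}
    (ht₀ : StrictMono t₀) {ε : ℝ} (hε : ∀ i j, i < j → 2 * ε < t₀ j - t₀ i) (hε0 : 0 ≤ ε)
    {j : Fin l} (hj : ∀ i, ε < |t i - t₀ j|) {S : Finset (Fin p)} {lo δ : ℝ} (hlo : 0 ≤ lo)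
    (h1 : ∀ u : Fin p → ℝ, (∀ c ∉ S, u c = 0) → lo * ∑ c, u c ^ 2 ≤
      ∑ i ∈ block n (n * (t₀ j - ε)) (n * t₀ j), (∑ c, x i c * u c) ^ 2)
    (h2 : ∀ u : Fin p → ℝ, (∀ c ∉ S, u c = 0) → lo * ∑ c, u c ^ 2 ≤
      ∑ i ∈ block n (n * t₀ j) (n * (t₀ j + ε)), (∑ c, x i c * u c) ^ 2)
    {β β₀ : Fin (l + 1) → Fin p → ℝ} (hβ : ∀ j, ∀ c ∉ S, β j c = 0)
    (hβ₀ : ∀ j, ∀ c ∉ S, β₀ j c = 0)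
    (hδ : δ ≤ ∑ c, (β₀ j.succ c - β₀ j.castSucc c) ^ 2) :
    lo * δ / 2 ≤ ∑ i, (regMean x t β i - regMean x t₀ β₀ i) ^ 2 := by
  set B₁ := block n (n * (t₀ j - ε)) (n * t₀ j) with hB₁
  set B₂ := block n (n * t₀ j) (n * (t₀ j + ε)) with hB₂
  have hn : (0 : ℝ) ≤ n := n.cast_nonneg
  have hle : (n : ℝ) * (t₀ j - ε) ≤ n * t₀ j := mul_le_mul_of_nonneg_left (by linarith) hn
  have hle' : (n : ℝ) * t₀ j ≤ n * (t₀ j + ε) := mul_le_mul_of_nonneg_left (by linarith) hn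
  -- the index of the segment of `t` around `t₀ j`
  obtain ⟨k, hk⟩ : ∃ k : Fin (l + 1), ∀ i ∈ B₁ ∪ B₂, segmentIndex t n i = k := by
    refine ⟨⟨(Finset.univ.filter fun k : Fin l => t k < t₀ j).card, Nat.lt_succ_of_le
      ((Finset.card_le_univ _).trans (Fintype.card_fin l).le)⟩, fun i hi => Fin.ext ?_⟩
    refine segmentIndex_val_eq_card (A := Finset.univ.filter fun k : Fin l => t k < t₀ j)
      fun k => ?_
    have hi' : (n : ℝ) * (t₀ j - ε) < (i : ℝ) + 1 ∧ (i : ℝ) + 1 ≤ n * (t₀ j + ε) := by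
      rcases Finset.mem_union.1 hi with h | h <;> rw [mem_block] at h
      · exact ⟨h.1, h.2.trans hle'⟩
      · exact ⟨hle.trans_lt h.1, h.2⟩
    simp only [Finset.mem_filter, Finset.mem_univ, true_and]
    rcases lt_abs.1 (hj k) with h | h
    · refine iff_of_false (not_lt.2 (hi'.2.trans ?_)) (by linarith)
      exact mul_le_mul_of_nonneg_left (by linarith) hn
    · refine iff_of_true (lt_of_le_of_lt ?_ hi'.1) (by linarith)
      exact mul_le_mul_of_nonneg_left (by linarith) hn
  have hs₁ : ∀ i ∈ B₁, segmentIndex t₀ n i = j.castSucc := by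
    intro i hi
    rw [mem_block] at hi
    refine Fin.ext ((segmentIndex_val_eq_card (A := Finset.Iio j) fun k => ?_).trans (by simp))
    rw [Finset.mem_Iio]
    constructor
    · intro h
      by_contra hkj
      have := mul_le_mul_of_nonneg_left (ht₀.monotone (not_lt.1 hkj)) hn
      linarith [hi.2]
    · intro h
      refine lt_of_le_of_lt (mul_le_mul_of_nonneg_left ?_ hn) hi.1
      linarith [hε k j h]
  have hs₂ : ∀ i ∈ B₂, segmentIndex t₀ n i = j.succ := by
    intro i hi
    rw [mem_block] at hi
    refine Fin.ext ((segmentIndex_val_eq_card (A := Finset.Iic j) fun k => ?_).trans (by simp))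
    rw [Finset.mem_Iic]
    constructor
    · intro h
      by_contra hkj
      have := mul_le_mul_of_nonneg_left
        (show t₀ j + ε ≤ t₀ k by linarith [hε j k (not_le.1 hkj)]) hn
      linarith [hi.2]
    · intro h
      exact lt_of_le_of_lt (mul_le_mul_of_nonneg_left (ht₀.monotone h) hn) hi.1
  have hdisj : Disjoint B₁ B₂ := by
    rw [Finset.disjoint_left]
    intro i hi hi'
    rw [mem_block] at hi hi'
    linarith [hi.2, hi'.1]
  have e₁ : ∑ i ∈ B₁, (∑ c, x i c * (β k c - β₀ j.castSucc c)) ^ 2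
      = ∑ i ∈ B₁, (regMean x t β i - regMean x t₀ β₀ i) ^ 2 := by
    refine Finset.sum_congr rfl fun i hi => ?_
    simp only [regMean, hk i (Finset.mem_union_left _ hi), hs₁ i hi, mul_sub,
      Finset.sum_sub_distrib]
  have e₂ : ∑ i ∈ B₂, (∑ c, x i c * (β k c - β₀ j.succ c)) ^ 2
      = ∑ i ∈ B₂, (regMean x t β i - regMean x t₀ β₀ i) ^ 2 := by
    refine Finset.sum_congr rfl fun i hi => ?_
    simp only [regMean, hk i (Finset.mem_union_right _ hi), hs₂ i hi, mul_sub,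
      Finset.sum_sub_distrib]
  have f₁ := h1 (fun c => β k c - β₀ j.castSucc c) fun c hc => by
    rw [hβ _ c hc, hβ₀ _ c hc, sub_self]
  have f₂ := h2 (fun c => β k c - β₀ j.succ c) fun c hc => by
    rw [hβ _ c hc, hβ₀ _ c hc, sub_self]
  rw [e₁] at f₁
  rw [e₂] at f₂
  have hsq : ∑ c, (β₀ j.succ c - β₀ j.castSucc c) ^ 2
      ≤ 2 * (∑ c, (β k c - β₀ j.castSucc c) ^ 2 + ∑ c, (β k c - β₀ j.succ c) ^ 2) := by
    rw [← Finset.sum_add_distrib, Finset.mul_sum]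
    refine Finset.sum_le_sum fun c _ => ?_
    nlinarith [sq_nonneg ((β k c - β₀ j.castSucc c) + (β k c - β₀ j.succ c))]
  calc lo * δ / 2
      ≤ lo * (∑ c, (β k c - β₀ j.castSucc c) ^ 2 + ∑ c, (β k c - β₀ j.succ c) ^ 2) := by
        rw [mul_div_assoc]
        exact mul_le_mul_of_nonneg_left (by linarith) hlo
    _ ≤ ∑ i ∈ B₁ ∪ B₂, (regMean x t β i - regMean x t₀ β₀ i) ^ 2 := by
        rw [Finset.sum_union hdisj, mul_add]
        exact add_le_add f₁ f₂
    _ ≤ _ := Finset.sum_le_univ_sum_of_nonneg fun _ => sq_nonneg _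

/-! ### Asymptotics -/

/-- The design condition for a single sequence of blocks of size at least `w n - 1`. -/
lemma DesignCondition.eventually_mul_sum_sq_le {p : ℕ → ℕ} {x : ∀ n, Fin n → Fin (p n) → ℝ}
    {q : ℕ → ℕ} {S : ∀ n, Finset (Fin (p n))} {a b : ℝ} (ha : 0 < a)
    (h : DesignCondition x q S a b) {w : ℕ → ℝ} (hw : Tendsto w atTop atTop)
    (hq : Tendsto (fun n => (q n : ℝ) / w n) atTop (𝓝 0)) {u v : ℕ → ℝ}
    (huv : ∀ᶠ n in atTop, w n - 1 ≤ (block n (u n) (v n)).card) :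
    ∀ᶠ n in atTop, ∀ z : Fin (p n) → ℝ, (∀ c ∉ S n, z c = 0) →
      a * (w n - 1) * ∑ c, z c ^ 2 ≤
        ∑ i ∈ block n (u n) (v n), (∑ c, x n i c * z c) ^ 2 := by
  have hcard : Tendsto (fun n => ((block n (u n) (v n)).card : ℝ)) atTop atTop :=
    tendsto_atTop_mono' _ huv (tendsto_atTop_add_const_right _ _ hw)
  have hq' : Tendsto (fun n => (q n : ℝ) / ((block n (u n) (v n)).card : ℝ)) atTop (𝓝 0) := by
    refine squeeze_zero' (g := fun n => 2 * ((q n : ℝ) / w n))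
      (Eventually.of_forall fun n => by positivity) ?_ (by simpa using hq.const_mul 2)
    filter_upwards [huv, hw.eventually_ge_atTop 2] with n h1 h2
    rw [div_le_iff₀ (by linarith)]
    calc (q n : ℝ) = 2 * (q n / w n) * (w n / 2) := by
          field_simp
      _ ≤ _ := by
          refine mul_le_mul_of_nonneg_left (by linarith) (by positivity)
  have := h 1 (fun n _ => block n (u n) (v n)) (fun n _ => ordConnected_block _ _ _)
    (fun n i j hij => absurd (Subsingleton.elim i j) hij)
    (fun _ => tendsto_natCast_atTop_iff.1 hcard) (fun _ => hq')
  filter_upwards [this, huv] with n hn h1 z hz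
  refine le_trans ?_ (mul_sum_sq_le_sum_sq_of_singularValuesIn (hn 0).1 hz)
  have : 0 ≤ ∑ c, z c ^ 2 := Finset.sum_nonneg fun _ _ => sq_nonneg _
  gcongr

lemma eq_zero_of_notMem_activeSet {l p : ℕ} {β : Fin (l + 1) → Fin p → ℝ} {c : Fin p}
    (hc : c ∉ activeSet β) (j : Fin (l + 1)) : β j c = 0 := by
  by_contra h
  exact hc (by simpa [activeSet] using ⟨j, h⟩)

/-- If locations stay farther than `ε n` from the true ones, then all regression functions with
these locations are at squared distance of order `n * ε n` from the true one. -/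
lemma eventually_le_sum_regMean_sub_sq {l : ℕ} {tstar : Fin l → ℝ} (htstar : IsLocation tstar)
    {p : ℕ → ℕ} {x : ∀ n, Fin n → Fin (p n) → ℝ} {βstar : ∀ n, Fin (l + 1) → Fin (p n) → ℝ}
    {δ : ℝ} (hδ : 0 < δ)
    (hjump : ∀ᶠ n in atTop, ∀ k : Fin l,
      δ ≤ ∑ c, (βstar n k.succ c - βstar n k.castSucc c) ^ 2)
    {q : ℕ → ℕ} {m : ∀ n, Finset (Fin (p n))} {a b : ℝ} (ha : 0 < a)
    (hdesign : DesignCondition x q (fun n => m n ∪ activeSet (βstar n)) a b)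
    {ε : ℕ → ℝ} (hε : Tendsto ε atTop (𝓝 0))
    (hnε : Tendsto (fun n : ℕ => (n : ℝ) * ε n) atTop atTop)
    (hq : Tendsto (fun n : ℕ => (q n : ℝ) / ((n : ℝ) * ε n)) atTop (𝓝 0))
    {t : ℕ → Fin l → ℝ} (ht : ∀ n, StrictMono (t n))
    (hfar : ∀ᶠ n in atTop, ∃ k, ε n < |t n k - tstar k|) :
    ∀ᶠ n : ℕ in atTop, ∀ β : Fin (l + 1) → Fin (p n) → ℝ, (∀ j, ∀ c ∉ m n, β j c = 0) →
      a * δ / 4 * (n * ε n) ≤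
        ∑ i, (regMean (x n) (t n) β i - regMean (x n) tstar (βstar n) i) ^ 2 := by
  have hgap : ∀ᶠ n in atTop, ∀ i j, i < j → 2 * ε n < tstar j - tstar i := by
    refine eventually_all.2 fun i => eventually_all.2 fun j => eventually_all.2 fun hij => ?_
    have h := htstar.1 hij
    filter_upwards [hε.eventually_lt_const (show 0 < (tstar j - tstar i) / 2 by linarith)]
      with n hn
    linarith
  have hin : ∀ᶠ n in atTop, ∀ j, ε n < tstar j ∧ ε n < 1 - tstar j := by
    refine eventually_all.2 fun j => ?_
    have h := htstar.2 j
    filter_upwards [hε.eventually_lt_const h.1,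
      hε.eventually_lt_const (show 0 < 1 - tstar j by linarith [h.2])] with n h1 h2 using ⟨h1, h2⟩
  have hex : ∀ᶠ n in atTop, ∃ j, ∀ i, ε n < |t n i - tstar j| := by
    filter_upwards [hgap, hfar] with n h1 h2 using exists_forall_lt_abs_sub (ht n) h1 h2
  obtain ⟨j, hj⟩ := hex.choice
  have hw1 : ∀ᶠ n : ℕ in atTop, (n : ℝ) * ε n - 1 ≤
      (block n (n * (tstar (j n) - ε n)) (n * tstar (j n))).card := by
    filter_upwards [hin, hnε.eventually_gt_atTop 0] with n h1 h2
    have hn : (0 : ℝ) ≤ n := n.cast_nonneg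
    have h3 := h1 (j n)
    have := le_card_block (n := n) (u := n * (tstar (j n) - ε n)) (v := n * tstar (j n))
      (mul_nonneg hn (by linarith)) (by linarith)
      (mul_le_of_le_one_right hn (htstar.2 _).2.le)
    linarith
  have hw2 : ∀ᶠ n : ℕ in atTop, (n : ℝ) * ε n - 1 ≤
      (block n (n * tstar (j n)) (n * (tstar (j n) + ε n))).card := by
    filter_upwards [hin, hnε.eventually_gt_atTop 0] with n h1 h2
    have hn : (0 : ℝ) ≤ n := n.cast_nonneg
    have h3 := h1 (j n)
    have := le_card_block (n := n) (u := n * tstar (j n)) (v := n * (tstar (j n) + ε n))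
      (mul_nonneg hn (htstar.2 _).1.le) (by linarith)
      (mul_le_of_le_one_right hn (by linarith))
    linarith
  filter_upwards [hgap, hj, hjump, hdesign.eventually_mul_sum_sq_le ha hnε hq hw1,
    hdesign.eventually_mul_sum_sq_le ha hnε hq hw2, hnε.eventually_ge_atTop 2]
    with n g1 g2 g3 g4 g5 g6 β hβ
  have hε0 : 0 ≤ ε n := (pos_of_mul_pos_right (by linarith) n.cast_nonneg).le
  refine le_trans ?_ (half_mul_le_sum_regMean_sub_sq htstar.1 g1 hε0 g2
    (mul_nonneg ha.le (by linarith)) g4 g5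
    (fun j c hc => hβ j c fun h => hc (Finset.mem_union_left _ h))
    (fun j c hc => eq_zero_of_notMem_activeSet (fun h => hc (Finset.mem_union_right _ h)) j)
    (g3 (j n)))
  have : a * δ / 4 * (n * ε n) ≤ a * δ / 4 * (2 * (n * ε n - 1)) :=
    mul_le_mul_of_nonneg_left (by linarith) (by positivity)
  linarith

/-- The Bayes factor vanishes in probability as soon as the misfit `n * ε n` dominates the
logarithm `q n * log n` of the prior mass near the true coefficients. -/
lemma tendstoInMeasure_bayesFactor {l : ℕ} {tstar : Fin l → ℝ} (htstar : IsLocation tstar)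
    {p : ℕ → ℕ} {x : ∀ n, Fin n → Fin (p n) → ℝ} {Kx : ℝ} (hx : ∀ n i c, |x n i c| ≤ Kx)
    {βstar : ∀ n, Fin (l + 1) → Fin (p n) → ℝ} {Kβ : ℝ} (hβ : ∀ n j c, |βstar n j c| ≤ Kβ)
    {δ : ℝ} (hδ : 0 < δ)
    (hjump : ∀ᶠ n in atTop, ∀ k : Fin l,
      δ ≤ ∑ c, (βstar n k.succ c - βstar n k.castSucc c) ^ 2)
    {σ2 : ℝ≥0} (hσ2 : 0 < σ2)
    {V : ℕ → ℝ≥0} {Vlo Vhi : ℝ≥0} (hVlo : 0 < Vlo) (hV : ∀ n, Vlo ≤ V n ∧ V n ≤ Vhi)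
    {q : ℕ → ℕ} (hqstar : ∀ᶠ n in atTop, (activeSet (βstar n)).card ≤ q n)
    {m : ∀ n, Finset (Fin (p n))} (hqm : ∀ᶠ n in atTop, (m n).card ≤ q n)
    {a b : ℝ} (ha : 0 < a)
    (hdesign : DesignCondition x q (fun n => m n ∪ activeSet (βstar n)) a b)
    {Ω : Type*} [MeasurableSpace Ω] {P : Measure Ω}
    {Y : ∀ n, Ω → Fin n → ℝ} (hY : ∀ n, HasLaw (Y n) (dataLaw (x n) tstar (βstar n) σ2) P)
    {ε : ℕ → ℝ} (hε : Tendsto ε atTop (𝓝 0))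
    (hnε : Tendsto (fun n : ℕ => (n : ℝ) * ε n) atTop atTop)
    (hq1 : ∀ᶠ n in atTop, 1 ≤ q n)
    (hq : Tendsto (fun n : ℕ => (q n : ℝ) * Real.log n / ((n : ℝ) * ε n)) atTop (𝓝 0))
    {t : ℕ → Fin l → ℝ} (ht : ∀ n, StrictMono (t n))
    (hfar : ∀ᶠ n in atTop, ∃ k, ε n < |t n k - tstar k|) :
    TendstoInMeasure P
      (fun n ω => bayesFactor (x n) σ2 (V n) (t n) (m n) tstar (activeSet (βstar n)) (Y n ω))
      atTop (fun _ => 0) := by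
  obtain ⟨κ, hκ0, hκ1, hκ⟩ := exists_le_gaussianPDFReal Vlo Vhi hVlo (Kβ + 1)
  have hσ : (0 : ℝ) < σ2 := by exact_mod_cast hσ2
  have hlog1 : ∀ᶠ n : ℕ in atTop, 1 ≤ Real.log n :=
    (Real.tendsto_log_atTop.comp tendsto_natCast_atTop_atTop).eventually_ge_atTop 1
  have hq' : Tendsto (fun n : ℕ => (q n : ℝ) / ((n : ℝ) * ε n)) atTop (𝓝 0) := by
    refine squeeze_zero' ?_ ?_ hq
    · filter_upwards [hnε.eventually_gt_atTop 0] with n hn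
      positivity
    · filter_upwards [hnε.eventually_gt_atTop 0, hlog1] with n hn hl
      gcongr
      exact le_mul_of_one_le_right (by positivity) hl
  have hsig := eventually_le_sum_regMean_sub_sq htstar hδ hjump ha hdesign hε hnε hq' ht hfar
  rw [tendstoInMeasure_iff_norm]
  intro η hη
  set A : ℝ := Kx ^ 2 + 1 with hAdef
  have hA1 : 1 ≤ A := by linarith [sq_nonneg Kx]
  set C : ℝ := |Real.log η| + 2 * A / σ2 + (l + 1) * (3 - Real.log κ)
  have hlκ : Real.log κ ≤ 0 := Real.log_nonpos hκ0.le hκ1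
  have hC : 0 < C := by
    have : (0 : ℝ) < (l + 1) * (3 - Real.log κ) := mul_pos (by positivity) (by linarith)
    positivity
  have hbound : Tendsto (fun n : ℕ =>
      ENNReal.ofReal (32 * σ2 * (l + 2) / (a * δ) * ((q n : ℝ) / (n * ε n)))
        + ENNReal.ofReal (σ2 * (1 / (n : ℝ)))) atTop (𝓝 0) := by
    have h1 := ENNReal.tendsto_ofReal (hq'.const_mul (32 * σ2 * (l + 2) / (a * δ)))
    have h2 := ENNReal.tendsto_ofReal (tendsto_one_div_atTop_nhds_zero_nat.const_mul (σ2 : ℝ))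
    simpa using h1.add h2
  refine tendsto_of_tendsto_of_tendsto_of_le_of_le' tendsto_const_nhds hbound
    (Eventually.of_forall fun _ => zero_le) ?_
  have hc0 : 0 < a * δ / (32 * σ2 * C) := by positivity
  filter_upwards [hsig, hlog1, hq1, hqstar, hqm, hnε.eventually_gt_atTop 0,
    hq.eventually_lt_const hc0, hq'.eventually_lt_const one_pos, hε.eventually_lt_const one_pos,
    eventually_ge_atTop 1] with n g1 g2 g3 g4 g5 g6 g7 g8 g9 g10
  have hn1 : (1 : ℝ) ≤ n := by exact_mod_cast g10
  have hn0 : (0 : ℝ) < n := by linarith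
  have hq1' : (1 : ℝ) ≤ q n := by exact_mod_cast g3
  have hqn : (q n : ℝ) ≤ n := by
    rw [div_lt_one g6] at g8
    exact g8.le.trans (mul_le_of_le_one_right hn0.le g9.le)
  have hms : ((activeSet (βstar n)).card : ℝ) ≤ q n := by exact_mod_cast g4
  have hm : ((m n).card : ℝ) ≤ q n := by exact_mod_cast g5
  set r : ℝ := ((n : ℝ) ^ 3)⁻¹ with hr
  have hr0 : 0 < r := by positivity
  have hr1 : r ≤ 1 := inv_le_one_of_one_le₀ (one_le_pow₀ hn1)
  set M : ℕ := (activeSet (βstar n)).card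
  -- on a box of radius `n⁻³` the regression functions differ by `O(n⁻²)`
  have hE : (n : ℝ) ^ 3 * ((M : ℝ) * (Kx * r)) ^ 2 ≤ Kx ^ 2 := by
    have : (n : ℝ) ^ 3 * ((M : ℝ) * (Kx * r)) ^ 2 = Kx ^ 2 * (M ^ 2 * r) := by
      rw [hr]; field_simp
    rw [this]
    refine mul_le_of_le_one_right (sq_nonneg _) ?_
    rw [hr, ← div_eq_mul_inv, div_le_one (by positivity)]
    calc (M : ℝ) ^ 2 ≤ (n : ℝ) ^ 2 :=
          pow_le_pow_left₀ (by positivity) (hms.trans hqn) 2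
      _ ≤ (n : ℝ) ^ 3 := pow_le_pow_right₀ hn1 (by norm_num)
  have hE0 : (n : ℝ) * ((M : ℝ) * (Kx * r)) ^ 2 ≤ A := by
    refine le_trans (mul_le_mul_of_nonneg_right ?_ (sq_nonneg _)) (hE.trans (by linarith))
    exact le_self_pow₀ hn1 (by norm_num)
  have hE1 : (n : ℝ) ^ 2 * (n * ((M : ℝ) * (Kx * r)) ^ 2) ≤ A ^ 2 := by
    calc (n : ℝ) ^ 2 * (n * ((M : ℝ) * (Kx * r)) ^ 2)
        = (n : ℝ) ^ 3 * ((M : ℝ) * (Kx * r)) ^ 2 := by ring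
      _ ≤ A := hE.trans (by linarith)
      _ ≤ A ^ 2 := le_self_pow₀ hA1 (by norm_num)
  -- in logarithms: the misfit exceeds the prior mass term, which is at most `C * (q n * log n)`
  have hηs : Real.exp (-(a * δ / 32 * (n * ε n)) / σ2) <
      η * (Real.exp (-(2 * A) / σ2) * (κ * r) ^ ((l + 1) * M)) := by
    have hκr : 0 < κ * r := by positivity
    rw [← Real.exp_log hη, ← Real.exp_log hκr, ← Real.exp_nat_mul, ← Real.exp_add,
      ← Real.exp_add, Real.exp_lt_exp, Real.log_mul hκ0.ne' hr0.ne', hr, Real.log_inv,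
      Real.log_pow]
    push_cast
    have hql : 1 ≤ (q n : ℝ) * Real.log n := one_le_mul_of_one_le_of_one_le hq1' g2
    have k1 : C * (q n * Real.log n) < a * δ / 32 * (n * ε n) / σ2 := by
      rw [div_lt_iff₀ g6] at g7
      calc C * (q n * Real.log n) < C * (a * δ / (32 * σ2 * C) * (n * ε n)) :=
            mul_lt_mul_of_pos_left g7 hC
        _ = _ := by field_simp
    have k2 : |Real.log η| ≤ |Real.log η| * (q n * Real.log n) :=
      le_mul_of_one_le_right (abs_nonneg _) hql
    have k3 : 2 * A / σ2 ≤ 2 * A / σ2 * (q n * Real.log n) :=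
      le_mul_of_one_le_right (by positivity) hql
    have k4 : (l + 1) * (M : ℝ) * (3 * Real.log n - Real.log κ)
        ≤ (l + 1) * (3 - Real.log κ) * (q n * Real.log n) := by
      have e1 : 3 * Real.log n - Real.log κ ≤ (3 - Real.log κ) * Real.log n := by
        nlinarith
      have e2 : (M : ℝ) * (3 * Real.log n - Real.log κ)
          ≤ q n * ((3 - Real.log κ) * Real.log n) :=
        mul_le_mul hms e1 (by linarith) (by positivity)
      calc (l + 1) * (M : ℝ) * (3 * Real.log n - Real.log κ)
          = (l + 1) * ((M : ℝ) * (3 * Real.log n - Real.log κ)) := by ring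
        _ ≤ (l + 1) * (q n * ((3 - Real.log κ) * Real.log n)) :=
            mul_le_mul_of_nonneg_left e2 (by positivity)
        _ = _ := by ring
    have k5 : C * (q n * Real.log n) = |Real.log η| * (q n * Real.log n)
        + 2 * A / σ2 * (q n * Real.log n)
        + (l + 1) * (3 - Real.log κ) * (q n * Real.log n) := by ring
    have k6 := neg_abs_le (Real.log η)
    rw [neg_div, neg_div]
    linarith
  -- `s' = n ^ 2`: the squared norm of the noise has mean `σ2 * n`, so it is below `n ^ 2` up to
  -- probability `σ2 / n`
  have key := measure_le_norm_bayesFactor_le (x n) (t n) tstar (m n) (activeSet (βstar n)) hσ2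
    (V := V n) (hVlo.trans_le (hV n).1).ne' (η := η) (s := a * δ / 32 * (n * ε n))
    (s' := (n : ℝ) ^ 2) hr0 hr1 (by positivity) (by positivity) (by linarith) hκ0
    (hκ (V n) (hV n).1 (hV n).2) (hx n) (hβ n)
    (fun j c hc => eq_zero_of_notMem_activeSet hc j) hE0 hE1
    (fun β hβ => le_trans (by linarith) (g1 β hβ)) hηs
  have hlaw := hY n
  simp only [sub_zero]
  calc P {ω | η ≤ ‖bayesFactor (x n) σ2 (V n) (t n) (m n) tstar (activeSet (βstar n)) (Y n ω)‖}
      ≤ P.map (Y n) {y | η ≤ ‖bayesFactor (x n) σ2 (V n) (t n) (m n) tstar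
          (activeSet (βstar n)) y‖} := Measure.le_map_apply hlaw.aemeasurable _
    _ ≤ ENNReal.ofReal (σ2 * ((l + 1) * (m n).card + 1) / (a * δ / 32 * (n * ε n)))
        + ENNReal.ofReal (σ2 * n / (n : ℝ) ^ 2) := by rw [hlaw.map_eq]; exact key
    _ ≤ _ := by
        refine add_le_add (ENNReal.ofReal_le_ofReal ?_) (ENNReal.ofReal_le_ofReal ?_)
        · have : ((l : ℝ) + 1) * (m n).card + 1 ≤ (l + 2) * q n := by
            have : ((l : ℝ) + 1) * (m n).card ≤ (l + 1) * q n :=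
              mul_le_mul_of_nonneg_left hm (by positivity)
            linarith
          calc σ2 * (((l : ℝ) + 1) * (m n).card + 1) / (a * δ / 32 * (n * ε n))
              ≤ σ2 * ((l + 2) * q n) / (a * δ / 32 * (n * ε n)) := by gcongr
            _ = _ := by field_simp
        · rw [sq]
          exact le_of_eq (by field_simp)

/-- The rate `(log n) ^ r / n` is admissible for `r > 4` and logarithmically many covariates. -/
lemma rateCondition_log_rpow_div {q : ℕ → ℕ}
    (hq : (fun n => (q n : ℝ)) =O[atTop] (fun n : ℕ => Real.log n)) {r : ℝ} (hr : 4 < r) :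
    RateCondition q fun n => Real.log n ^ r / (n : ℝ) := by
  have hlog : Tendsto (fun n : ℕ => Real.log n) atTop atTop :=
    Real.tendsto_log_atTop.comp tendsto_natCast_atTop_atTop
  have hmul : (fun n : ℕ => (n : ℝ) * (Real.log n ^ r / (n : ℝ))) =ᶠ[atTop]
      fun n : ℕ => Real.log n ^ r := by
    filter_upwards [eventually_ge_atTop 1] with n hn
    have : (n : ℝ) ≠ 0 := by positivity
    field_simp
  obtain ⟨C, hC0, hC⟩ := hq.exists_pos
  have hC' := hC.bound
  refine ⟨?_, ?_, ?_, 1 / 4, by norm_num, C ^ 2, ?_⟩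
  · have h := (isLittleO_log_rpow_rpow_atTop r (one_pos)).tendsto_div_nhds_zero
    simpa [Function.comp_def] using h.comp tendsto_natCast_atTop_atTop
  · exact ((tendsto_rpow_atTop (by linarith)).comp hlog).congr' hmul.symm
  · have hneg : Tendsto (fun n : ℕ => C ^ 2 * Real.log n ^ (-(r - 4))) atTop (𝓝 0) := by
      have := (tendsto_rpow_neg_atTop (show 0 < r - 4 by linarith)).comp hlog
      simpa using this.const_mul (C ^ 2)
    refine squeeze_zero' ?_ ?_ hneg
    · filter_upwards [hlog.eventually_gt_atTop 0] with n h1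
      positivity
    · filter_upwards [hlog.eventually_gt_atTop 0, hmul, hC'] with n h1 h2 h3
      rw [h2, div_le_iff₀ (by positivity), mul_assoc, ← Real.rpow_add h1]
      rw [Real.norm_of_nonneg (by positivity), Real.norm_of_nonneg h1.le] at h3
      have h4 : Real.log n ^ (-(r - 4) + r) = Real.log n ^ 4 := by
        rw [← Real.rpow_natCast]; congr 1; push_cast; ring
      rw [h4]
      calc ((q n : ℝ) * Real.log n) ^ 2 ≤ (C * Real.log n * Real.log n) ^ 2 := by gcongr
        _ = C ^ 2 * Real.log n ^ 4 := by ring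
  · have h := ((isLittleO_log_rpow_rpow_atTop 2
      (show (0 : ℝ) < 1 / 4 by norm_num)).comp_tendsto tendsto_natCast_atTop_atTop).bound one_pos
    filter_upwards [hC', h, hlog.eventually_gt_atTop 0] with n h1 h2 h3
    rw [Real.norm_of_nonneg (by positivity), Real.norm_of_nonneg h3.le] at h1
    simp only [Function.comp_apply, one_mul, Real.rpow_two] at h2
    rw [Real.norm_of_nonneg (by positivity), Real.norm_of_nonneg (by positivity)] at h2
    calc (q n : ℝ) ^ 2 ≤ (C * Real.log n) ^ 2 := by gcongr
      _ = C ^ 2 * Real.log n ^ 2 := by ring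
      _ ≤ _ := by gcongr

end ChangePoint

theorem mainTheorem2
    -- the true change points and the array of designs
    (l : ℕ) (tstar : Fin l → ℝ) (htstar : ChangePoint.IsLocation tstar)
    (p : ℕ → ℕ) (x : ∀ n, Fin n → Fin (p n) → ℝ)
    -- the covariates are uniformly bounded
    (Kx : ℝ) (hx : ∀ n i c, |x n i c| ≤ Kx)
    -- the true coefficients are uniformly bounded and do not merge at a change point
    (βstar : ∀ n, Fin (l + 1) → Fin (p n) → ℝ)
    (Kβ : ℝ) (hβ : ∀ n j c, |βstar n j c| ≤ Kβ)
    (δ : ℝ) (hδ : 0 < δ)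
    (hjump : ∀ᶠ n in atTop, ∀ k : Fin l,
      δ ≤ ∑ c, (βstar n k.succ c - βstar n k.castSucc c) ^ 2)
    -- the known error variance and the prior variances
    (σ2 : ℝ≥0) (hσ2 : 0 < σ2)
    (V : ℕ → ℝ≥0) (Vlo Vhi : ℝ≥0) (hVlo : 0 < Vlo) (hV : ∀ n, Vlo ≤ V n ∧ V n ≤ Vhi)
    -- at most `q n` covariates in the true model and in the alternative model
    (q : ℕ → ℕ)
    (hqstar : ∀ᶠ n in atTop, (ChangePoint.activeSet (βstar n)).card ≤ q n)
    (m : ∀ n, Finset (Fin (p n))) (hqm : ∀ᶠ n in atTop, (m n).card ≤ q n)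
    -- the singular value condition for the designs
    (a b : ℝ) (ha : 0 < a) (hb : 0 < b)
    (hdesign : ChangePoint.DesignCondition x q
      (fun n => m n ∪ ChangePoint.activeSet (βstar n)) a b)
    -- the responses, distributed according to the true model
    {Ω : Type*} [MeasurableSpace Ω] (P : Measure Ω) [IsProbabilityMeasure P]
    (Y : ∀ n, Ω → Fin n → ℝ)
    (hY : ∀ n, HasLaw (Y n) (ChangePoint.dataLaw (x n) tstar (βstar n) σ2) P) :
    (∀ ε : ℕ → ℝ, ChangePoint.RateCondition q ε →
      ∀ t : ℕ → Fin l → ℝ, (∀ n, ChangePoint.IsLocation (t n)) →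
        (∀ᶠ n in atTop, ∃ k, ε n < |t n k - tstar k|) →
        TendstoInMeasure P
          (fun n ω => ChangePoint.bayesFactor (x n) σ2 (V n) (t n) (m n)
            tstar (ChangePoint.activeSet (βstar n)) (Y n ω))
          atTop (fun _ => 0)) ∧
    ((fun n => (q n : ℝ)) =O[atTop] (fun n : ℕ => Real.log n) →
      ∀ r : ℝ, 4 < r →
      ∀ t : ℕ → Fin l → ℝ, (∀ n, ChangePoint.IsLocation (t n)) →
        (∀ᶠ n : ℕ in atTop, ∃ k, Real.log n ^ r / (n : ℝ) < |t n k - tstar k|) →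
        TendstoInMeasure P
          (fun n ω => ChangePoint.bayesFactor (x n) σ2 (V n) (t n) (m n)
            tstar (ChangePoint.activeSet (βstar n)) (Y n ω))
          atTop (fun _ => 0)) := by
  have main : ∀ ε : ℕ → ℝ, ChangePoint.RateCondition q ε →
      ∀ t : ℕ → Fin l → ℝ, (∀ n, ChangePoint.IsLocation (t n)) →
        (∀ᶠ n in atTop, ∃ k, ε n < |t n k - tstar k|) →
        TendstoInMeasure P
          (fun n ω => ChangePoint.bayesFactor (x n) σ2 (V n) (t n) (m n)
            tstar (ChangePoint.activeSet (βstar n)) (Y n ω))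
          atTop (fun _ => 0) := by
    intro ε hε t ht hfar
    -- a jump of the coefficients requires an active covariate
    have hq1 : ∀ᶠ n in atTop, 1 ≤ q n := by
      filter_upwards [hfar, hjump, hqstar] with n ⟨k, _⟩ h2 h3
      refine le_trans (Finset.card_pos.2 ?_) h3
      by_contra hne
      rw [Finset.not_nonempty_iff_eq_empty] at hne
      have h0 : ∀ j c, βstar n j c = 0 := fun j c =>
        ChangePoint.eq_zero_of_notMem_activeSet (by simp [hne]) j
      have := h2 k
      simp only [h0, sub_self, ne_eq, OfNat.ofNat_ne_zero, not_false_eq_true, zero_pow,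
        Finset.sum_const_zero] at this
      linarith
    refine ChangePoint.tendstoInMeasure_bayesFactor htstar hx hβ hδ hjump hσ2 hVlo hV hqstar hqm
      ha hdesign hY hε.1 hε.2.1 hq1 ?_ (fun n => (ht n).1) hfar
    have hlog1 : ∀ᶠ n : ℕ in atTop, 1 ≤ Real.log n :=
      (Real.tendsto_log_atTop.comp tendsto_natCast_atTop_atTop).eventually_ge_atTop 1
    refine squeeze_zero' ?_ ?_ hε.2.2.1
    · filter_upwards [hlog1, hε.2.1.eventually_gt_atTop 0] with n h1 h2
      positivity
    · filter_upwards [hlog1, hε.2.1.eventually_gt_atTop 0, hq1] with n h1 h2 h3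
      have h4 : (1 : ℝ) ≤ q n := by exact_mod_cast h3
      gcongr
      exact le_self_pow₀ (one_le_mul_of_one_le_of_one_le h4 h1) two_ne_zero
  exact ⟨main, fun hq r hr t ht hfar =>
    main _ (ChangePoint.rateCondition_log_rpow_div hq hr) t ht hfar⟩
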